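/- (Ax's theorem.) Let $p$ be a prime, $q=p^e$ with $e\ge 1$, let $\mathbb{F}_q$ be the finite field with $q$ elements, and let $k\ge 1$ and $d\ge 1$ be integers. For $f\in\mathbb{F}_q[x_1,\ldots,x_k]$ let $N(f=0)$ denote the number of points $x\in\mathbb{F}_q^k$ with $f(x)=0$. Then for every polynomial $f\in\mathbb{F}_q[x_1,\ldots,x_k]$ of total degree $d$, the number $N(f=0)$ is divisible by $q^{\lceil k/d\rceil-1}$. Furthermore, there exists a polynomial $f\in\mathbb{F}_q[x_1,\ldots,x_k]$ of total degree $d$ for which this is sharp, in the sense that the exact power of $p$ dividing $N(f=0)$ is $q^{\lceil k/d\rceil-1}$, i.e. $N(f=0)\neq 0$ and $\nu_p(N(f=0))=e(\lceil k/d\rceil-1)$. -/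

import Mathlib

/-- `N(f = 0)`: the number of points `x ∈ F^k` with `f(x) = 0`. -/
noncomputable def numZeros {F : Type*} [Field F] {k : ℕ} (f : MvPolynomial (Fin k) F) : ℕ :=
  Nat.card {x : Fin k → F // MvPolynomial.eval x f = 0}

/-!
Lift `f` to a polynomial `g` over the Witt vectors of `F`, a domain of characteristic zero with
uniformizer `p`, using the Teichmüller map `τ`. As `n` grows, `1 - g(τ x) ^ (p ^ n * (q - 1))` tends
`p`-adically to the indicator of `f x = 0`. Expanding the power over the exponents `u` of `g`, and
summing over `x`, leaves a combination of multinomial coefficients indexed by families `j`, each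
multiplied by one character sum for every variable `l`. These sums vanish unless `q - 1` divides
every column sum `∑ u, j u * u l`, and a column sum equal to `0` contributes a factor `q`.

By Legendre's formula the `p`-adic valuation of the multinomial coefficient is governed by the base
`p` digit sums of the `j u`. Rotating the `e`-digit expansions of the `j u` multiplies them by a
power of `p` modulo `q - 1`, hence preserves the divisibility of the column sums. Bounding the
column sums of each rotated family by the degree of `g` and averaging over the `e` rotations bounds
the digit sums from below.

For sharpness, `k ≤ d` is settled by a monomial in all the variables. Adding to a polynomial in
`m ≥ 1` variables with `N` zeros the product of `d` new variables gives
`q ^ m * (q - 1) ^ (d - 1) + q * N * A` zeros, where `A` is the number of zeros of a product of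
`d - 1` variables and is prime to `p` when `d > 1`. If `⌈m / d⌉ < m` the first term has the larger
valuation, so that the valuation of `N` grows by exactly that of `q` when `⌈m / d⌉` grows by one. If
`⌈m / d⌉ = m`, the zero polynomial in `m` variables can be taken instead.
-/

open Finset

/-- The cyclic shift by `h` places of the digit string `L` (least significant digit first), read in
base `p` with the positions taken modulo `e`. Digits beyond the first `e` wrap around, so no bound
on the length of `L` is needed. -/
def rotatedOfDigits (p e : ℕ) : ℕ → List ℕ → ℕ
  | _, [] => 0
  | h, a :: L => a * p ^ (h % e) + rotatedOfDigits p e (h + 1) L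

section Digits

variable {p : ℕ}

theorem rotatedOfDigits_add_period (p e h : ℕ) (L : List ℕ) :
    rotatedOfDigits p e (h + e) L = rotatedOfDigits p e h L := by
  induction L generalizing h with
  | nil => rfl
  | cons a L ih => simp only [rotatedOfDigits, Nat.add_mod_right, add_right_comm h e 1, ih]

theorem rotatedOfDigits_eq_zero_iff (hp : 0 < p) (e h : ℕ) (L : List ℕ) :
    rotatedOfDigits p e h L = 0 ↔ Nat.ofDigits p L = 0 := by
  induction L generalizing h with
  | nil => rfl
  | cons a L ih => simp [rotatedOfDigits, Nat.ofDigits_cons, ih, hp.ne']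

theorem pow_mod_modEq_pow (hp : 0 < p) (e h : ℕ) : p ^ (h % e) ≡ p ^ h [MOD p ^ e - 1] := by
  have hone : 1 ≡ p ^ e [MOD p ^ e - 1] := (Nat.modEq_iff_dvd' (Nat.one_le_pow _ _ hp)).2 dvd_rfl
  conv_rhs => rw [← Nat.div_add_mod h e, pow_add, pow_mul]
  simpa using (hone.pow (h / e)).mul_right (p ^ (h % e))

theorem rotatedOfDigits_modEq (hp : 0 < p) (e h : ℕ) (L : List ℕ) :
    rotatedOfDigits p e h L ≡ p ^ h * Nat.ofDigits p L [MOD p ^ e - 1] := by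
  induction L generalizing h with
  | nil => rfl
  | cons a L ih =>
    calc a * p ^ (h % e) + rotatedOfDigits p e (h + 1) L
        ≡ a * p ^ h + p ^ (h + 1) * Nat.ofDigits p L [MOD p ^ e - 1] :=
          ((pow_mod_modEq_pow hp e h).mul_left a).add (ih (h + 1))
      _ = p ^ h * Nat.ofDigits p (a :: L) := by simp only [Nat.ofDigits_cons]; ring

theorem sub_one_mul_sum_rotatedOfDigits (hp : 1 < p) (e : ℕ) (L : List ℕ) :
    (p - 1) * ∑ h ∈ range e, rotatedOfDigits p e h L = L.sum * (p ^ e - 1) := by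
  induction L with
  | nil => simp [rotatedOfDigits]
  | cons a L ih =>
    have hshift : ∑ h ∈ range e, rotatedOfDigits p e (h + 1) L =
        ∑ h ∈ range e, rotatedOfDigits p e h L := by
      have hwrap := rotatedOfDigits_add_period p e 0 L
      rw [zero_add] at hwrap
      refine Nat.add_right_cancel (m := rotatedOfDigits p e 0 L) ?_
      rw [← sum_range_succ' (rotatedOfDigits p e · L), sum_range_succ, hwrap]
    have hgeom : (p - 1) * ∑ h ∈ range e, p ^ (h % e) = p ^ e - 1 := by
      rw [sum_congr rfl fun h hh => by rw [Nat.mod_eq_of_lt (mem_range.1 hh)], mul_comm,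
        Nat.geomSum_eq hp, Nat.div_mul_cancel]
      simpa using Nat.sub_dvd_pow_sub_pow p 1 e
    simp only [rotatedOfDigits]
    rw [sum_add_distrib, ← mul_sum, hshift, mul_add, mul_left_comm, hgeom, ih, List.sum_cons,
      add_mul]

theorem digits_pow_sub_one_sum (hp : 1 < p) (e : ℕ) :
    (p.digits (p ^ e - 1)).sum = (p - 1) * e := by
  induction e with
  | zero => simp
  | succ e ih =>
    have hpos : 1 ≤ p ^ e := Nat.one_le_pow _ _ (by omega)
    have hcons : p ^ (e + 1) - 1 = (p - 1) + p * (p ^ e - 1) := by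
      have := Nat.mul_le_mul_left p hpos
      rw [Nat.mul_sub, pow_succ']
      omega
    rw [hcons, Nat.digits_add p hp _ _ (by omega) (by omega), List.sum_cons, ih]
    ring

theorem digits_pow_mul_sum (hp : 1 < p) (n m : ℕ) :
    (p.digits (p ^ n * m)).sum = (p.digits m).sum := by
  rcases Nat.eq_zero_or_pos m with rfl | hm
  · simp
  · simp [Nat.digits_base_pow_mul hp hm]

theorem sum_digits_sum_eq_multinomial [hp : Fact p.Prime] {ι : Type*} (s : Finset ι) (j : ι → ℕ) :
    ∑ i ∈ s, (p.digits (j i)).sum =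
      (p - 1) * padicValNat p (Nat.multinomial s j) + (p.digits (∑ i ∈ s, j i)).sum := by
  have legendre (n : ℕ) : (p - 1) * padicValNat p n.factorial + (p.digits n).sum = n := by
    rw [sub_one_mul_padicValNat_factorial, Nat.sub_add_cancel (Nat.digit_sum_le p n)]
  have hval : ∑ i ∈ s, padicValNat p (j i).factorial + padicValNat p (Nat.multinomial s j) =
      padicValNat p (∑ i ∈ s, j i).factorial := by
    have hfact : ∀ i ∈ s, (j i).factorial ≠ 0 := fun i _ => Nat.factorial_ne_zero _
    rw [← Nat.multinomial_spec s j,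
      padicValNat.mul (prod_ne_zero_iff.2 hfact) (Nat.multinomial_pos s j).ne']
    simp only [← Nat.factorization_def _ hp.out, Nat.factorization_prod_apply hfact]
  have hterms : (p - 1) * ∑ i ∈ s, padicValNat p (j i).factorial + ∑ i ∈ s, (p.digits (j i)).sum =
      ∑ i ∈ s, j i := by
    rw [mul_sum, ← sum_add_distrib]
    exact sum_congr rfl fun i _ => legendre (j i)
  have htotal := legendre (∑ i ∈ s, j i)
  rw [← hval, mul_add] at htotal
  omega

end Digits

section Exponents

variable {ι σ : Type*} [Fintype σ] {p e d : ℕ} {s : Finset ι} {u : ι → σ → ℕ}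

theorem mul_ceilDiv_le_sum_add {Q : ℕ} (hQ : 0 < Q) (hd : 0 < d) (hu : ∀ i ∈ s, ∑ l, u i l ≤ d)
    {w : ι → ℕ} (hw : Q ∣ ∑ i ∈ s, w i) (hcol : ∀ l, Q ∣ ∑ i ∈ s, w i * u i l) :
    Q * (Fintype.card σ ⌈/⌉ d) ≤ ∑ i ∈ s, w i + Q * #{l | ∑ i ∈ s, w i * u i l = 0} := by
  obtain ⟨c, hc⟩ := hw
  set zeros := #{l | ∑ i ∈ s, w i * u i l = 0}
  set nonzeros := #{l | ∑ i ∈ s, w i * u i l ≠ 0}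
  have hcard : zeros + nonzeros = Fintype.card σ := card_filter_add_card_filter_not _
  have hnonzeros : nonzeros * Q ≤ d * c * Q :=
    calc nonzeros * Q ≤ ∑ l with ∑ i ∈ s, w i * u i l ≠ 0, ∑ i ∈ s, w i * u i l :=
          card_nsmul_le_sum _ _ _ fun l hl =>
            Nat.le_of_dvd (Nat.pos_of_ne_zero (mem_filter.1 hl).2) (hcol l)
      _ ≤ ∑ l, ∑ i ∈ s, w i * u i l := sum_le_sum_of_subset (filter_subset _ _)
      _ = ∑ i ∈ s, w i * ∑ l, u i l := by simp only [mul_sum]; exact sum_comm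
      _ ≤ ∑ i ∈ s, w i * d := sum_le_sum fun i hi => Nat.mul_le_mul_left _ (hu i hi)
      _ = d * c * Q := by rw [← sum_mul, hc]; ring
  have hceil : Fintype.card σ ⌈/⌉ d ≤ c + zeros := by
    rw [ceilDiv_le_iff_le_mul hd, ← hcard, mul_add, add_comm]
    exact add_le_add (Nat.le_of_mul_le_mul_right hnonzeros hQ) (Nat.le_mul_of_pos_left _ hd)
  rw [hc, ← mul_add]
  exact Nat.mul_le_mul_left Q hceil

theorem mul_ceilDiv_le_sum_rotatedOfDigits_add (hp : 1 < p) (he : e ≠ 0) (hd : 0 < d)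
    (hu : ∀ i ∈ s, ∑ l, u i l ≤ d) {j : ι → ℕ} (hj : p ^ e - 1 ∣ ∑ i ∈ s, j i)
    (hcol : ∀ l, p ^ e - 1 ∣ ∑ i ∈ s, j i * u i l) (h : ℕ) :
    (p ^ e - 1) * (Fintype.card σ ⌈/⌉ d) ≤ ∑ i ∈ s, rotatedOfDigits p e h (p.digits (j i)) +
      (p ^ e - 1) * #{l | ∑ i ∈ s, j i * u i l = 0} := by
  have hp0 : 0 < p := by omega
  have hQ : 0 < p ^ e - 1 := Nat.sub_pos_of_lt (Nat.one_lt_pow he hp)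
  set ρ := fun i => rotatedOfDigits p e h (p.digits (j i))
  have hmod (i : ι) : ρ i ≡ p ^ h * j i [MOD p ^ e - 1] := by
    simpa only [Nat.ofDigits_digits] using rotatedOfDigits_modEq hp0 e h (p.digits (j i))
  have hzero (i : ι) : ρ i = 0 ↔ j i = 0 := by
    simpa only [Nat.ofDigits_digits] using rotatedOfDigits_eq_zero_iff hp0 e h (p.digits (j i))
  have hρ : p ^ e - 1 ∣ ∑ i ∈ s, ρ i := by
    refine ((Nat.ModEq.sum fun i _ => hmod i).dvd_iff dvd_rfl).2 ?_
    rw [← mul_sum]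
    exact hj.mul_left _
  have hρcol (l : σ) : p ^ e - 1 ∣ ∑ i ∈ s, ρ i * u i l := by
    refine ((Nat.ModEq.sum fun i _ => (hmod i).mul_right (u i l)).dvd_iff dvd_rfl).2 ?_
    simp only [mul_assoc, ← mul_sum]
    exact (hcol l).mul_left _
  simpa only [sum_eq_zero_iff, mul_eq_zero, hzero] using mul_ceilDiv_le_sum_add hQ hd hu hρ hρcol

theorem mul_ceilDiv_le_sum_digits_sum_add (hp : 1 < p) (he : e ≠ 0) (hd : 0 < d)
    (hu : ∀ i ∈ s, ∑ l, u i l ≤ d) {j : ι → ℕ} (hj : p ^ e - 1 ∣ ∑ i ∈ s, j i)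
    (hcol : ∀ l, p ^ e - 1 ∣ ∑ i ∈ s, j i * u i l) :
    (p - 1) * (e * (Fintype.card σ ⌈/⌉ d)) ≤
      ∑ i ∈ s, (p.digits (j i)).sum + (p - 1) * (e * #{l | ∑ i ∈ s, j i * u i l = 0}) := by
  set ρ := fun h i => rotatedOfDigits p e h (p.digits (j i))
  set zeros := #{l | ∑ i ∈ s, j i * u i l = 0}
  have hsum : e * ((p ^ e - 1) * (Fintype.card σ ⌈/⌉ d)) ≤
      ∑ i ∈ s, ∑ h ∈ range e, ρ h i + e * ((p ^ e - 1) * zeros) := by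
    rw [sum_comm]
    simpa only [sum_add_distrib, sum_const, card_range, smul_eq_mul] using
      sum_le_sum fun h (_ : h ∈ range e) =>
        mul_ceilDiv_le_sum_rotatedOfDigits_add hp he hd hu hj hcol h
  have hdigits : (p - 1) * ∑ i ∈ s, ∑ h ∈ range e, ρ h i =
      (∑ i ∈ s, (p.digits (j i)).sum) * (p ^ e - 1) := by
    rw [mul_sum, sum_mul]
    exact sum_congr rfl fun i _ => sub_one_mul_sum_rotatedOfDigits hp e (p.digits (j i))
  refine Nat.le_of_mul_le_mul_right ?_ (Nat.sub_pos_of_lt (Nat.one_lt_pow he hp))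
  linarith [Nat.mul_le_mul_left (p - 1) hsum]

theorem pow_dvd_multinomial_mul [hp : Fact p.Prime] {n : ℕ} (he : e ≠ 0) (hd : 0 < d)
    (hu : ∀ i ∈ s, ∑ l, u i l ≤ d) {j : ι → ℕ} (hj : ∑ i ∈ s, j i = p ^ n * (p ^ e - 1))
    (hcol : ∀ l, p ^ e - 1 ∣ ∑ i ∈ s, j i * u i l) :
    p ^ (e * (Fintype.card σ ⌈/⌉ d - 1)) ∣
      Nat.multinomial s j * (p ^ e) ^ #{l | ∑ i ∈ s, j i * u i l = 0} := by
  have hp1 := hp.out.one_lt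
  have hdigits := mul_ceilDiv_le_sum_digits_sum_add hp1 he hd hu (hj ▸ dvd_mul_left _ _) hcol
  rw [sum_digits_sum_eq_multinomial, hj, digits_pow_mul_sum hp1, digits_pow_sub_one_sum hp1,
    ← mul_add, ← mul_add] at hdigits
  have hval := Nat.le_of_mul_le_mul_left hdigits (by omega)
  set v := padicValNat p (Nat.multinomial s j)
  set zeros := #{l | ∑ i ∈ s, j i * u i l = 0}
  calc p ^ (e * (Fintype.card σ ⌈/⌉ d - 1)) ∣ p ^ (v + e * zeros) :=
        pow_dvd_pow p (by rw [Nat.mul_sub]; omega)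
    _ = p ^ v * (p ^ e) ^ zeros := by rw [pow_add, pow_mul]
    _ ∣ Nat.multinomial s j * (p ^ e) ^ zeros := mul_dvd_mul_right pow_padicValNat_dvd _

end Exponents

theorem eval_pow_eq_sum_piAntidiag {R σ : Type*} [CommSemiring R] [Fintype σ] [DecidableEq σ]
    (g : MvPolynomial σ R) (x : σ → R) (m : ℕ) :
    MvPolynomial.eval x g ^ m = ∑ j ∈ g.support.piAntidiag m,
      (Nat.multinomial g.support j : R) * (∏ u ∈ g.support, g.coeff u ^ j u) *
        ∏ l, x l ^ ∑ u ∈ g.support, j u * u l := by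
  rw [MvPolynomial.eval_eq', sum_pow_eq_sum_piAntidiag]
  refine sum_congr rfl fun j _ => ?_
  rw [mul_assoc]
  simp only [mul_pow, prod_mul_distrib, ← prod_pow, ← pow_mul, ← prod_pow_eq_pow_sum]
  rw [prod_comm]
  simp only [mul_comm (j _)]

theorem exists_map_eq_totalDegree_le {R S σ : Type*} [CommSemiring R] [CommSemiring S]
    {π : R →+* S} (hπ : Function.Surjective π) (f : MvPolynomial σ S) :
    ∃ g : MvPolynomial σ R, MvPolynomial.map π g = f ∧ g.totalDegree ≤ f.totalDegree := by
  refine ⟨∑ u ∈ f.support, MvPolynomial.monomial u (Function.surjInv hπ (f.coeff u)), ?_, ?_⟩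
  · simp only [map_sum, MvPolynomial.map_monomial, Function.surjInv_eq]
    exact f.support_sum_monomial_coeff
  · exact MvPolynomial.totalDegree_finsetSum_le fun u hu =>
      (MvPolynomial.totalDegree_monomial_le u _).trans (MvPolynomial.le_totalDegree hu)

section MultiplicativeLift

variable {F R σ : Type*} [Field F] [Fintype F] [CommRing R] [Fintype σ] (χ : F →* R)

theorem sum_prod_pow_eq_prod_sum_pow [DecidableEq σ] (n : σ → ℕ) :
    ∑ x : σ → F, ∏ l, χ (x l) ^ n l = ∏ l, ∑ t, χ t ^ n l := by
  rw [prod_univ_sum, Fintype.piFinset_univ]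

theorem card_pow_dvd_prod_sum_pow (n : σ → ℕ) :
    (Fintype.card F : R) ^ #{l | n l = 0} ∣ ∏ l, ∑ t, χ t ^ n l := by
  rw [← prod_filter_mul_prod_filter_not univ (fun l => n l = 0),
    prod_congr rfl fun l hl => by rw [(mem_filter.1 hl).2]]
  simp

variable [IsDomain R] {χ} (hχ : Function.Injective χ)
include hχ

theorem sum_pow_eq_zero_of_not_card_sub_one_dvd {n : ℕ} (hn : ¬ Fintype.card F - 1 ∣ n) :
    ∑ t, χ t ^ n = 0 := by
  obtain ⟨a, ha⟩ : ∃ a : Fˣ, a ^ n ≠ 1 := by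
    simpa using mt (FiniteField.forall_pow_eq_one_iff F n).1 hn
  have hinvariant : χ a ^ n * ∑ t, χ t ^ n = ∑ t, χ t ^ n := by
    rw [mul_sum]
    refine Fintype.sum_equiv (Equiv.mulLeft₀ (a : F) a.ne_zero) _ _ fun t => ?_
    simp [mul_pow]
  have hne : χ a ^ n ≠ 1 := by
    rw [← map_pow, ← map_one χ, hχ.ne_iff, ← Units.val_pow_eq_pow_val]
    exact mt Units.val_eq_one.1 ha
  by_contra hsum
  exact hne (mul_right_cancel₀ hsum (hinvariant.trans (one_mul _).symm))

theorem pow_dvd_sum_eval_pow [DecidableEq σ] {p e d : ℕ} [Fact p.Prime]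
    (hF : Fintype.card F = p ^ e) (hd : 0 < d) {g : MvPolynomial σ R}
    (hg : g.totalDegree ≤ d) (n : ℕ) :
    (p : R) ^ (e * (Fintype.card σ ⌈/⌉ d - 1)) ∣
      ∑ x : σ → F, MvPolynomial.eval (χ ∘ x) g ^ (p ^ n * (p ^ e - 1)) := by
  have he : e ≠ 0 := by
    rintro rfl
    exact Fintype.one_lt_card.ne' hF
  simp only [eval_pow_eq_sum_piAntidiag, Function.comp_apply]
  rw [sum_comm]
  refine dvd_sum fun j hj => ?_
  rw [← mul_sum, sum_prod_pow_eq_prod_sum_pow]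
  by_cases hcol : ∀ l, p ^ e - 1 ∣ ∑ u ∈ g.support, j u * u l
  · have hu : ∀ u ∈ g.support, ∑ l, u l ≤ d := fun u hu => by
      simpa [Finsupp.sum_fintype] using (MvPolynomial.le_totalDegree hu).trans hg
    have hmultinomial := Nat.cast_dvd_cast (α := R)
      (pow_dvd_multinomial_mul he hd hu (mem_piAntidiag.1 hj).1 hcol)
    have hzeros := card_pow_dvd_prod_sum_pow χ fun l => ∑ u ∈ g.support, j u * u l
    rw [hF] at hzeros
    push_cast at hmultinomial hzeros
    exact hmultinomial.trans (mul_dvd_mul (dvd_mul_right _ _) hzeros)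
  · push Not at hcol
    obtain ⟨l, hl⟩ := hcol
    rw [prod_eq_zero (mem_univ l) (sum_pow_eq_zero_of_not_card_sub_one_dvd hχ (hF ▸ hl)), mul_zero]
    exact dvd_zero _

end MultiplicativeLift

section Reduction

variable {R F : Type*} [CommRing R] [Field F] {p : ℕ}

theorem pow_dvd_of_cast_pow_dvd_cast [IsDomain R] [CharP F p] (π : R →+* F) (hp : (p : R) ≠ 0)
    {a N : ℕ} (h : (p : R) ^ a ∣ N) : p ^ a ∣ N := by
  induction a generalizing N with
  | zero => simp
  | succ a ih =>
    have hN : (N : F) = 0 := by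
      have := map_dvd π ((dvd_pow_self _ a.succ_ne_zero).trans h)
      rwa [map_natCast, map_natCast, CharP.cast_eq_zero, zero_dvd_iff] at this
    obtain ⟨m, rfl⟩ := (CharP.cast_eq_zero_iff F p N).1 hN
    rw [pow_succ', Nat.cast_mul] at h
    rw [pow_succ']
    exact mul_dvd_mul_left p (ih ((mul_dvd_mul_iff_left hp).1 h))

theorem pow_dvd_one_sub_pow_sub_indicator [Fintype F] [DecidableEq F] [hp : Fact p.Prime]
    {π : R →+* F} (hπ : ∀ T, π T = 0 → (p : R) ∣ T) (T : R) (n : ℕ) :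
    (p : R) ^ n ∣
      (1 - T ^ (p ^ n * (Fintype.card F - 1))) - (if π T = 0 then 1 else 0) := by
  split_ifs with hT
  · have hn : n ≤ p ^ n * (Fintype.card F - 1) :=
      (Nat.lt_pow_self hp.out.one_lt).le.trans
        (Nat.le_mul_of_pos_right _ (Nat.sub_pos_of_lt Fintype.one_lt_card))
    rw [sub_sub_cancel_left, dvd_neg]
    exact (pow_dvd_pow_of_dvd (hπ T hT) n).trans (pow_dvd_pow T hn)
  · have hunit : (p : R) ∣ 1 - T ^ (Fintype.card F - 1) :=
      hπ _ (by simp [FiniteField.pow_card_sub_one_eq_one _ hT])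
    have hpow := dvd_sub_pow_of_dvd_sub hunit n
    rw [one_pow, ← pow_mul, mul_comm] at hpow
    rw [sub_zero]
    exact (pow_dvd_pow _ n.le_succ).trans hpow

end Reduction

theorem ceilDiv_le_self {d : ℕ} (hd : 0 < d) (k : ℕ) : k ⌈/⌉ d ≤ k :=
  (ceilDiv_le_iff_le_mul hd).2 (Nat.le_mul_of_pos_left k hd)

theorem card_pow_dvd_natCard_zeros {F σ : Type*} [Field F] [Fintype F] [Fintype σ] {d : ℕ}
    (hd : 0 < d) {f : MvPolynomial σ F} (hf : f.totalDegree ≤ d) :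
    Fintype.card F ^ (Fintype.card σ ⌈/⌉ d - 1) ∣
      Nat.card {x : σ → F // MvPolynomial.eval x f = 0} := by
  classical
  obtain ⟨p, _⟩ := CharP.exists F
  obtain ⟨e, hp, hF⟩ := FiniteField.card F p
  have : Fact p.Prime := ⟨hp⟩
  let π : WittVector p F →+* F := WittVector.constantCoeff
  let τ : F →* WittVector p F := WittVector.teichmuller p
  have hπτ (a : F) : π (τ a) = a := WittVector.teichmuller_coeff_zero p a
  have hπ (T : WittVector p F) (hT : π T = 0) : (p : WittVector p F) ∣ T := by
    rwa [← Ideal.mem_span_singleton, ← WittVector.ker_constantCoeff, RingHom.mem_ker]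
  obtain ⟨g, rfl, hg⟩ := exists_map_eq_totalDegree_le (Function.RightInverse.surjective hπτ) f
  have heval (x : σ → F) : π (MvPolynomial.eval (τ ∘ x) g) =
      MvPolynomial.eval x (MvPolynomial.map π g) := by
    rw [MvPolynomial.eval₂_comp, MvPolynomial.eval_map]
    simp only [Function.comp_def, hπτ]
  set n := e * (Fintype.card σ ⌈/⌉ d - 1)
  have hpowers := pow_dvd_sum_eval_pow (Function.LeftInverse.injective hπτ) hF hd (hg.trans hf) n
  have hcount :
      (Nat.card {x : σ → F // MvPolynomial.eval x (MvPolynomial.map π g) = 0} : WittVector p F) =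
        ∑ x : σ → F, if π (MvPolynomial.eval (τ ∘ x) g) = 0 then 1 else 0 := by
    simp only [heval, Nat.card_eq_fintype_card, Fintype.card_subtype, sum_boole]
  have hindicator := dvd_sum fun (x : σ → F) (_ : x ∈ univ) =>
    pow_dvd_one_sub_pow_sub_indicator hπ (MvPolynomial.eval (τ ∘ x) g) n
  have hpoints : (p : WittVector p F) ^ n ∣ ∑ _x : σ → F, 1 := by
    rw [sum_const, card_univ, Fintype.card_fun, hF, nsmul_one, ← pow_mul, Nat.cast_pow]
    exact pow_dvd_pow _ (Nat.mul_le_mul_left _ ((Nat.sub_le _ _).trans (ceilDiv_le_self hd _)))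
  rw [sum_sub_distrib, sum_sub_distrib, ← hcount, hF] at hindicator
  rw [hF, ← pow_mul]
  exact pow_dvd_of_cast_pow_dvd_cast π (WittVector.p_nonzero p F)
    ((dvd_sub_right (dvd_sub hpoints hpowers)).1 hindicator)

section Counting

variable {F : Type*} [Field F] [Fintype F]

theorem cast_card_sub_one : ((Fintype.card F - 1 : ℕ) : F) = -1 := by
  rw [Nat.cast_sub Fintype.card_pos, FiniteField.cast_card_eq_zero, Nat.cast_one, zero_sub]

variable [DecidableEq F]

theorem numZeros_eq_card_filter {k : ℕ} (f : MvPolynomial (Fin k) F) :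
    numZeros f = #{x : Fin k → F | MvPolynomial.eval x f = 0} := by
  rw [numZeros, Nat.card_eq_fintype_card, Fintype.card_subtype]

theorem card_prod_ne_zero {σ : Type*} [Fintype σ] [DecidableEq σ] :
    #{z : σ → F | ∏ l, z l ≠ 0} = (Fintype.card F - 1) ^ Fintype.card σ := by
  have hpi : ({z : σ → F | ∏ l, z l ≠ 0} : Finset (σ → F)) =
      Fintype.piFinset fun _ => univ.erase 0 := by
    ext z
    simp [prod_ne_zero_iff]
  rw [hpi, Fintype.card_piFinset, prod_const, card_univ, card_erase_of_mem (mem_univ 0), card_univ]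

theorem cast_card_prod_eq_zero_ne_zero {σ : Type*} [Fintype σ] [DecidableEq σ] [Nonempty σ] :
    (#{z : σ → F | ∏ l, z l = 0} : F) ≠ 0 := by
  intro hzero
  have hcount := card_filter_add_card_filter_not (s := univ) fun z : σ → F => ∏ l, z l = 0
  rw [card_prod_ne_zero, card_univ, Fintype.card_fun] at hcount
  have hcast := congrArg (Nat.cast : ℕ → F) hcount
  rw [Nat.cast_add, hzero, Nat.cast_pow, Nat.cast_pow, cast_card_sub_one,
    FiniteField.cast_card_eq_zero, zero_pow Fintype.card_ne_zero, zero_add] at hcast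
  exact pow_ne_zero _ (neg_ne_zero.2 one_ne_zero) hcast

theorem card_add_mul_eq_zero (a c : F) :
    #{y | a + y * c = 0} = if c = 0 then (if a = 0 then Fintype.card F else 0) else 1 := by
  split_ifs with hc ha
  · simp [hc, ha]
  · simp [hc, ha]
  · refine card_eq_one.2 ⟨-a / c, ?_⟩
    ext y
    simp [eq_div_iff hc, eq_neg_iff_add_eq_zero, add_comm]

theorem card_add_mul_eq_zero_of_separated {X Z : Type*} [Fintype X] [Fintype Z] (φ : X → F)
    (c : Z → F) :
    #{t : X × F × Z | φ t.1 + t.2.1 * c t.2.2 = 0} = Fintype.card X * #{z | c z ≠ 0} +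
      Fintype.card F * (#{x | φ x = 0} * #{z | c z = 0}) := by
  have hline (x : X) (z : Z) : (∑ y, if φ x + y * c z = 0 then 1 else 0) =
      (if c z ≠ 0 then 1 else 0) +
        Fintype.card F * ((if φ x = 0 then 1 else 0) * if c z = 0 then 1 else 0) := by
    rw [← card_filter, card_add_mul_eq_zero]
    split_ifs <;> simp_all
  calc #{t : X × F × Z | φ t.1 + t.2.1 * c t.2.2 = 0}
      = ∑ x, ∑ z, ∑ y, if φ x + y * c z = 0 then 1 else 0 := by
        rw [card_filter, Fintype.sum_prod_type]
        exact sum_congr rfl fun x _ => by rw [Fintype.sum_prod_type, sum_comm]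
    _ = _ := by
        simp only [hline, sum_add_distrib, ← mul_sum, ← sum_mul, ← card_filter, sum_const,
          card_univ, smul_eq_mul]

end Counting

/-- `f + z₁ ⋯ z_d`, where the `z_j` are `d` new variables placed after those of `f`. -/
noncomputable def addProdNewVars {R : Type*} [CommSemiring R] {m : ℕ} (f : MvPolynomial (Fin m) R)
    (d : ℕ) : MvPolynomial (Fin (m + d)) R :=
  MvPolynomial.rename (Fin.castAdd d) f + ∏ j, MvPolynomial.X (Fin.natAdd m j)

section AddProdNewVars

theorem totalDegree_addProdNewVars {R : Type*} [CommSemiring R] [Nontrivial R] {m d : ℕ}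
    (hd : d ≠ 0) {f : MvPolynomial (Fin m) R} (hf : f.totalDegree ≤ d) :
    (addProdNewVars f d).totalDegree = d := by
  have hmonomial : (∏ j, MvPolynomial.X (Fin.natAdd m j) : MvPolynomial (Fin (m + d)) R) =
      MvPolynomial.monomial (∑ j : Fin d, Finsupp.single (Fin.natAdd m j) 1) 1 :=
    (MvPolynomial.monomial_sum_one _ _).symm
  have hdegree : (∑ j : Fin d, Finsupp.single (Fin.natAdd m j) 1).degree = d := by
    simp
  set v := ∑ j : Fin d, Finsupp.single (Fin.natAdd m j) 1
  apply le_antisymm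
  · refine (MvPolynomial.totalDegree_add _ _).trans (max_le ?_ ?_)
    · exact (MvPolynomial.totalDegree_rename_le _ f).trans hf
    · rw [hmonomial]
      exact (MvPolynomial.totalDegree_monomial_le v 1).trans hdegree.le
  · have hrename : (MvPolynomial.rename (Fin.castAdd d) f).coeff v = 0 := by
      let j₀ : Fin d := ⟨0, Nat.pos_of_ne_zero hd⟩
      have hj₀ : v (Fin.natAdd m j₀) = 1 := by
        simp [v, Finsupp.finsetSum_apply, Finsupp.single_apply, (Fin.natAdd_injective d m).eq_iff]
      have hnotMem : Fin.natAdd m j₀ ∉ Set.range (Fin.castAdd d) := by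
        rintro ⟨l, hl⟩
        exact (l.isLt.trans_le (Nat.le_add_right m j₀)).ne (congrArg Fin.val hl)
      refine MvPolynomial.coeff_rename_eq_zero _ _ _ fun s hs => ?_
      rw [← hs, Finsupp.mapDomain_of_notMem_range _ _ hnotMem] at hj₀
      exact absurd hj₀ zero_ne_one
    have hcoeff : (addProdNewVars f d).coeff v = 1 := by
      rw [addProdNewVars, MvPolynomial.coeff_add, hrename, hmonomial, MvPolynomial.coeff_monomial,
        if_pos rfl, zero_add]
    have hv : v ∈ (addProdNewVars f d).support := by
      simp [MvPolynomial.mem_support_iff, hcoeff]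
    exact hdegree.ge.trans (MvPolynomial.le_totalDegree hv)

theorem numZeros_addProdNewVars {F : Type*} [Field F] [Fintype F] [DecidableEq F] {m : ℕ}
    (f : MvPolynomial (Fin m) F) (D : ℕ) :
    numZeros (addProdNewVars f (D + 1)) = Fintype.card F ^ m * (Fintype.card F - 1) ^ D +
      Fintype.card F * (numZeros f * #{z : Fin D → F | ∏ j, z j = 0}) := by
  let E : (Fin m → F) × F × (Fin D → F) ≃ (Fin (m + (D + 1)) → F) :=
    ((Equiv.refl _).prodCongr (Fin.consEquiv fun _ => F)).trans (Fin.appendEquiv m (D + 1))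
  have heval (t : (Fin m → F) × F × (Fin D → F)) :
      MvPolynomial.eval (E t) (addProdNewVars f (D + 1)) =
        MvPolynomial.eval t.1 f + t.2.1 * ∏ j, t.2.2 j := by
    have hold : E t ∘ Fin.castAdd (D + 1) = t.1 := funext fun l => Fin.append_left _ _ l
    have hnew (j : Fin (D + 1)) :
        E t (Fin.natAdd m j) = (Fin.cons t.2.1 t.2.2 : Fin (D + 1) → F) j :=
      Fin.append_right _ _ j
    simp [addProdNewVars, MvPolynomial.eval_rename, hold, hnew, Fin.prod_univ_succ]
  rw [numZeros_eq_card_filter, numZeros_eq_card_filter]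
  calc #{x | MvPolynomial.eval x (addProdNewVars f (D + 1)) = 0}
      = #{t : (Fin m → F) × F × (Fin D → F) |
          MvPolynomial.eval t.1 f + t.2.1 * ∏ j, t.2.2 j = 0} := by
        refine (card_equiv E fun t => ?_).symm
        simp only [mem_filter_univ, heval]
    _ = _ := by
        rw [card_add_mul_eq_zero_of_separated (fun x => MvPolynomial.eval x f), Fintype.card_fun,
          card_prod_ne_zero, Fintype.card_fin, Fintype.card_fin]

theorem numZeros_addProdNewVars_eq_pow_mul {F : Type*} [Field F] [Fintype F] [DecidableEq F]
    {m r b : ℕ} (hr : r ≤ m) {f : MvPolynomial (Fin m) F}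
    (hf : Fintype.card F * numZeros f = Fintype.card F ^ r * b) (D : ℕ) :
    numZeros (addProdNewVars f (D + 1)) = Fintype.card F ^ r *
      (Fintype.card F ^ (m - r) * (Fintype.card F - 1) ^ D +
        b * #{z : Fin D → F | ∏ j, z j = 0}) := by
  rw [numZeros_addProdNewVars, ← mul_assoc (Fintype.card F), hf, mul_add, ← mul_assoc, ← mul_assoc,
    ← pow_add, Nat.add_sub_cancel' hr]

end AddProdNewVars

section Sharpness

variable {F : Type*} [Field F]

theorem exists_cast_numZeros_ne_zero [Finite F] {k d : ℕ} (hk : k ≠ 0) (hkd : k ≤ d) :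
    ∃ f : MvPolynomial (Fin k) F, f.totalDegree = d ∧ (numZeros f : F) ≠ 0 := by
  classical
  have := Fintype.ofFinite F
  have : NeZero k := ⟨hk⟩
  refine ⟨MvPolynomial.X 0 ^ (d - k) * ∏ l, MvPolynomial.X l, ?_, ?_⟩
  · have hprod : (∏ l, MvPolynomial.X l : MvPolynomial (Fin k) F) =
        MvPolynomial.monomial (∑ l, Finsupp.single l 1) 1 :=
      (MvPolynomial.monomial_sum_one _ _).symm
    rw [hprod, MvPolynomial.X_pow_eq_monomial, MvPolynomial.monomial_mul, mul_one,
      MvPolynomial.totalDegree_monomial _ one_ne_zero]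
    calc (Finsupp.single 0 (d - k) + ∑ l : Fin k, Finsupp.single l 1).degree = d - k + k := by
          simp only [map_add, map_sum, Finsupp.degree_single, sum_const, card_univ,
            Fintype.card_fin, smul_eq_mul, mul_one]
      _ = d := Nat.sub_add_cancel hkd
  · have hzeros (x : Fin k → F) : MvPolynomial.eval x
        (MvPolynomial.X 0 ^ (d - k) * ∏ l, MvPolynomial.X l) = 0 ↔ ∏ l, x l = 0 := by
      simp only [map_mul, map_pow, map_prod, MvPolynomial.eval_X, mul_eq_zero]
      exact or_iff_right_of_imp fun h => prod_eq_zero (mem_univ 0) (eq_zero_of_pow_eq_zero h)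
    simpa only [numZeros_eq_card_filter, hzeros] using cast_card_prod_eq_zero_ne_zero

theorem add_self_ceilDiv {d : ℕ} (hd : 0 < d) (m : ℕ) : (m + d) ⌈/⌉ d = m ⌈/⌉ d + 1 := by
  rw [Nat.ceilDiv_eq_add_pred_div, Nat.ceilDiv_eq_add_pred_div, ← Nat.add_div_right _ hd]
  congr 1
  omega

variable [Fintype F]

theorem exists_totalDegree_eq_numZeros_eq_add_self {m d : ℕ} (hm : m ≠ 0) (hd : d ≠ 0)
    (h : ∃ g : MvPolynomial (Fin m) F, g.totalDegree = d ∧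
      ∃ b : ℕ, (b : F) ≠ 0 ∧ numZeros g = Fintype.card F ^ (m ⌈/⌉ d - 1) * b) :
    ∃ f : MvPolynomial (Fin (m + d)) F, f.totalDegree = d ∧
      ∃ b : ℕ, (b : F) ≠ 0 ∧ numZeros f = Fintype.card F ^ ((m + d) ⌈/⌉ d - 1) * b := by
  classical
  have hdpos := Nat.pos_of_ne_zero hd
  obtain ⟨D, rfl⟩ := Nat.exists_add_one_eq.2 hdpos
  have hrm := ceilDiv_le_self hdpos m
  have hr : m ⌈/⌉ (D + 1) ≠ 0 := fun hzero => hm <| by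
    simpa [hzero] using (ceilDiv_le_iff_le_mul hdpos (b := m) (c := 0)).1
  rw [add_self_ceilDiv hdpos, Nat.add_sub_cancel]
  rcases hrm.eq_or_lt with hfull | hlt
  · have hzero : Fintype.card F * numZeros (0 : MvPolynomial (Fin m) F) =
        Fintype.card F ^ (m ⌈/⌉ (D + 1)) * Fintype.card F := by
      simp [numZeros_eq_card_filter, hfull, mul_comm]
    refine ⟨addProdNewVars 0 (D + 1), totalDegree_addProdNewVars hd (by simp), _, ?_,
      numZeros_addProdNewVars_eq_pow_mul hrm hzero D⟩
    simp [hfull, cast_card_sub_one]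
  · have hD : D ≠ 0 := by
      rintro rfl
      simp at hlt
    have : NeZero D := ⟨hD⟩
    obtain ⟨g, hg, b, hb, hgb⟩ := h
    have hstep : Fintype.card F * numZeros g = Fintype.card F ^ (m ⌈/⌉ (D + 1)) * b := by
      rw [hgb, ← mul_assoc, mul_pow_sub_one hr]
    refine ⟨addProdNewVars g (D + 1), totalDegree_addProdNewVars hd hg.le, _, ?_,
      numZeros_addProdNewVars_eq_pow_mul hrm hstep D⟩
    have hA : (#{z : Fin D → F | ∏ j, z j = 0} : F) ≠ 0 := cast_card_prod_eq_zero_ne_zero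
    rw [Nat.cast_add, Nat.cast_mul, Nat.cast_pow, FiniteField.cast_card_eq_zero,
      zero_pow (Nat.sub_ne_zero_of_lt hlt), zero_mul, zero_add, Nat.cast_mul]
    exact mul_ne_zero hb hA

theorem exists_totalDegree_eq_numZeros_eq {k d : ℕ} (hk : k ≠ 0) (hd : d ≠ 0) :
    ∃ f : MvPolynomial (Fin k) F, f.totalDegree = d ∧
      ∃ b : ℕ, (b : F) ≠ 0 ∧ numZeros f = Fintype.card F ^ (k ⌈/⌉ d - 1) * b := by
  have hdpos := Nat.pos_of_ne_zero hd
  induction k using Nat.strong_induction_on with | _ k ih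
  rcases le_or_gt k d with hkd | hkd
  · obtain ⟨f, hf, hb⟩ := exists_cast_numZeros_ne_zero (F := F) hk hkd
    have hceil : k ⌈/⌉ d ≤ 1 := (ceilDiv_le_iff_le_mul hdpos).2 (by rwa [mul_one])
    exact ⟨f, hf, numZeros f, hb, by rw [Nat.sub_eq_zero_of_le hceil, pow_zero, one_mul]⟩
  · obtain ⟨m, rfl⟩ := Nat.exists_eq_add_of_le' hkd.le
    have hm : m ≠ 0 := by omega
    exact exists_totalDegree_eq_numZeros_eq_add_self hm hd (ih m (by omega) hm)

end Sharpness

theorem ceil_div_eq_ceilDiv {d : ℕ} (hd : 0 < d) (k : ℕ) : ⌈(k : ℚ) / d⌉₊ = k ⌈/⌉ d :=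
  eq_of_forall_ge_iff fun c => by
    rw [Nat.ceil_le, div_le_iff₀' (Nat.cast_pos.2 hd), ceilDiv_le_iff_le_mul hd]
    exact_mod_cast Iff.rfl

theorem mainTheorem9 {F : Type*} [Field F] [Fintype F] (p e q : ℕ) (hp : p.Prime)
    (hq : q = p ^ e) (hF : Fintype.card F = q) (k d : ℕ) (hk : 1 ≤ k) (hd : 1 ≤ d) :
    (∀ f : MvPolynomial (Fin k) F, f.totalDegree = d →
      q ^ (⌈(k : ℚ) / (d : ℚ)⌉₊ - 1) ∣ numZeros f) ∧
    (∃ f : MvPolynomial (Fin k) F, f.totalDegree = d ∧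
      emultiplicity p (numZeros f) = ((e * (⌈(k : ℚ) / (d : ℚ)⌉₊ - 1) : ℕ) : ℕ∞)) := by
  subst hq
  have : Fact p.Prime := ⟨hp⟩
  have : CharP F p := by
    refine (CharP.charP_iff_prime_eq_zero hp).2 (eq_zero_of_pow_eq_zero (n := e) ?_)
    rw [← Nat.cast_pow, ← hF, FiniteField.cast_card_eq_zero]
  rw [ceil_div_eq_ceilDiv hd k]
  constructor
  · intro f hf
    simpa only [hF, Fintype.card_fin, numZeros] using card_pow_dvd_natCard_zeros hd hf.le
  · obtain ⟨f, hf, b, hb, hfb⟩ :=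
      exists_totalDegree_eq_numZeros_eq (F := F) (Nat.ne_of_gt hk) (Nat.ne_of_gt hd)
    have hpb : ¬ p ∣ b := mt (CharP.cast_eq_zero_iff F p b).2 hb
    refine ⟨f, hf, ?_⟩
    rw [hfb, hF, ← pow_mul, hp.emultiplicity_mul, hp.emultiplicity_pow_self,
      emultiplicity_eq_zero.2 hpb, add_zero]
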